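/- Let $S$ be an integrally closed domain and let $E$ be a finitely generated torsionfree $S$-module of rank $r$. Choose an embedding $\varphi\colon E\hookrightarrow S^r$. For a submodule $N\subseteq S^r$, let $\mathcal R(N)\subseteq S[T_1,\dots,T_r]$ be the $S$-subalgebra generated by all linear forms $a_1T_1+\cdots+a_rT_r$ with $(a_1,\dots,a_r)\in N$. A submodule $F$ with $N\subseteq F\subseteq S^r$ is integral over $N$ if $\mathcal R(F)$ is integral over $\mathcal R(N)$, and the integral closure $\overline N$ is the largest submodule of $S^r$ integral over $N$. The module $E$ is integrally closed if $\overline{\varphi(E)}=\varphi(E)$ (this does not depend on $\varphi$). Let $\det(E)$ denote the rank one torsionfree module $\bigwedge^r E$ modulo its torsion (equivalently, the image of $\bigwedge^r E$ in $\bigwedge^r S^r=S$). It is divisorial if it is isomorphic to a nonzero fractional ideal $I$ of $S$ with $(I^{-1})^{-1}=I$. If $E$ is integrally closed and $\det(E)$ is divisorial, then $E$ is reflexive, i.e. the natural map $E\to \operatorname{Hom}_S(\operatorname{Hom}_S(E,S),S)$ is an isomorphism. -/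

import Mathlib

open scoped nonZeroDivisors

namespace ReesModule

variable {S : Type*} [CommRing S] {n : ℕ}

/-- The linear form `a₁T₁ + ⋯ + aₙTₙ` attached to a vector `(a₁, …, aₙ)` of `Sⁿ`. -/
noncomputable def linearForm (S : Type*) [CommRing S] (n : ℕ) :
    (Fin n → S) →ₗ[S] MvPolynomial (Fin n) S :=
  ∑ i : Fin n, (LinearMap.proj i : (Fin n → S) →ₗ[S] S).smulRight (MvPolynomial.X i)

theorem linearForm_apply (a : Fin n → S) :
    linearForm S n a = ∑ i : Fin n, MvPolynomial.C (a i) * MvPolynomial.X i := by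
  simp [linearForm, MvPolynomial.smul_eq_C_mul]

/-- The Rees algebra of a submodule `N` of `Sⁿ`: the subalgebra of `S[T₁, …, Tₙ]` generated by the
linear forms whose coefficient vectors lie in `N`. -/
noncomputable def reesAlgebra (N : Submodule S (Fin n → S)) :
    Subalgebra S (MvPolynomial (Fin n) S) :=
  Algebra.adjoin S (linearForm S n '' (N : Set (Fin n → S)))

/-- The submodule `F` of `Sⁿ` contains `N` and is integral over `N`: the Rees algebra of `F` is
integral over the Rees algebra of `N`. -/
def IsIntegralOver (N F : Submodule S (Fin n → S)) : Prop :=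
  N ≤ F ∧ ∀ f ∈ reesAlgebra F, IsIntegral (reesAlgebra N) f

/-- The integral closure of a submodule `N` of `Sⁿ`: the largest submodule of `Sⁿ` which is
integral over `N` (see `isGreatest_integralClosure`). -/
noncomputable def integralClosure (N : Submodule S (Fin n → S)) : Submodule S (Fin n → S) :=
  sSup {F | IsIntegralOver N F}

theorem isIntegralOver_iff (N F : Submodule S (Fin n → S)) :
    IsIntegralOver N F ↔ N ≤ F ∧ ∀ x ∈ F, IsIntegral (reesAlgebra N) (linearForm S n x) := by
  constructor
  · rintro ⟨h, h'⟩
    exact ⟨h, fun x hx => h' _ (Algebra.subset_adjoin ⟨x, hx, rfl⟩)⟩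
  · rintro ⟨h, h'⟩
    refine ⟨h, fun f hf => ?_⟩
    have hle : reesAlgebra F ≤
        (_root_.integralClosure (reesAlgebra N) (MvPolynomial (Fin n) S)).restrictScalars S := by
      refine Algebra.adjoin_le ?_
      rintro _ ⟨x, hx, rfl⟩
      exact h' x hx
    exact hle hf

theorem isGreatest_integralClosure (N : Submodule S (Fin n → S)) :
    IsGreatest {F | IsIntegralOver N F} (integralClosure N) := by
  refine ⟨?_, fun F hF => le_sSup hF⟩
  have hN : IsIntegralOver N N := (isIntegralOver_iff N N).2 ⟨le_rfl, fun x hx =>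
    isIntegral_algebraMap (R := reesAlgebra N)
      (x := ⟨linearForm S n x, Algebra.subset_adjoin ⟨x, hx, rfl⟩⟩)⟩
  refine (isIntegralOver_iff N _).2 ⟨le_sSup hN, ?_⟩
  have hle : integralClosure N ≤ (Subalgebra.toSubmodule
      ((_root_.integralClosure (reesAlgebra N)
        (MvPolynomial (Fin n) S)).restrictScalars S)).comap (linearForm S n) :=
    sSup_le fun F hF x hx => ((isIntegralOver_iff N F).1 hF).2 x hx
  exact fun x hx => hle hx

/-- The module `E`, embedded in `S^r` with `r` the rank of `E`, equals its integral closure. For a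
finitely generated torsionfree module over an integrally closed domain such embeddings exist and
the condition does not depend on the chosen one. -/
def IsIntegrallyClosedModule (S E : Type*) [CommRing S] [AddCommGroup E] [Module S E] : Prop :=
  ∃ φ : E →ₗ[S] (Fin (Module.finrank S E) → S), Function.Injective φ ∧
    integralClosure (LinearMap.range φ) = LinearMap.range φ

/-- The determinant of a module `E` of rank `r`: the module `⋀ʳ E` modulo its torsion. For an
embedding `φ : E → S^r`, it is identified with the image of `⋀ʳ E` in `⋀ʳ S^r = S`, that is, with
the ideal of maximal minors of `φ`. -/
abbrev Determinant (S E : Type*) [CommRing S] [AddCommGroup E] [Module S E] : Type _ :=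
  (⋀[S]^(Module.finrank S E) E) ⧸ Submodule.torsion S (⋀[S]^(Module.finrank S E) E)

/-- A rank one module `M` over a domain `S` is divisorial if it is isomorphic to a divisorial
fractional ideal, i.e. a nonzero fractional ideal `I` with `(I⁻¹)⁻¹ = I`. -/
def IsDivisorial (S M : Type*) [CommRing S] [IsDomain S] [AddCommGroup M] [Module S M] : Prop :=
  ∃ I : FractionalIdeal S⁰ (FractionRing S), I ≠ 0 ∧ I⁻¹⁻¹ = I ∧ Nonempty (M ≃ₗ[S] I)

end ReesModule

/-! ### Cramer's rule and the determinant trick. -/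

namespace ReesModule

variable {S : Type*} [CommRing S] {n : ℕ}

/-! Let `J` be the ideal of maximal minors of `φ` and `x` the coordinate vector in `S^r` of a bidual
element `ξ`. Fix a matrix `v` with rows in `φ E`. For `c` in the inverse of `J`, the map sending `y`
to `c` times the determinant of `v` with row `i` replaced by `φ y` is a functional on `E`; applying
`ξ` puts `c` times the determinant with row `x` in `S`. Since `J` is divisorial, that determinant
lies in `J` (`det_updateRow_bidualCoord_mem`). By Cramer's rule the linear form of `x` then
stabilizes the extension of `J` to the Rees algebra, so `x` is integral over `φ E`
(`mem_integralClosure_of_det_updateRow_mem`). As `E` is integrally closed, `x = φ e`, and `ξ` is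
evaluation at `e` (`bidual_eq_eval`). -/

theorem sum_det_updateRow_smul (v : Matrix (Fin n) (Fin n) S) (z : Fin n → S) :
    ∑ i, (v.updateRow i z).det • v i = v.det • z := by
  have h := Matrix.mulVec_cramer v.transpose z
  rw [Matrix.det_transpose] at h
  rw [← h]
  ext j
  simp [Matrix.mulVec, dotProduct, Matrix.cramer_transpose_apply, mul_comm]

theorem mem_integralClosure_of_isIntegral {N : Submodule S (Fin n → S)} {x : Fin n → S}
    (hx : IsIntegral (reesAlgebra N) (linearForm S n x)) : x ∈ integralClosure N := by
  let F : Submodule S (Fin n → S) := (Subalgebra.toSubmodule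
      ((_root_.integralClosure (reesAlgebra N)
        (MvPolynomial (Fin n) S)).restrictScalars S)).comap (linearForm S n)
  have hF : IsIntegralOver N F := (isIntegralOver_iff N F).2 ⟨fun y hy =>
    isIntegral_algebraMap (R := reesAlgebra N)
      (x := ⟨linearForm S n y, Algebra.subset_adjoin ⟨y, hy, rfl⟩⟩), fun y hy => hy⟩
  exact (isGreatest_integralClosure N).2 hF hx

/-- The determinant trick: if replacing a row by `x` keeps the maximal minors of `N` in the ideal
they generate, then `x` is integral over `N`. -/
theorem mem_integralClosure_of_det_updateRow_mem [IsDomain S] {N : Submodule S (Fin n → S)}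
    {I : Ideal S} (hfg : I.FG) (h0 : I ≠ ⊥)
    (hI : I = Ideal.span {d | ∃ v : Matrix (Fin n) (Fin n) S, (∀ i, v i ∈ N) ∧ v.det = d})
    {x : Fin n → S}
    (hx : ∀ v : Matrix (Fin n) (Fin n) S, (∀ i, v i ∈ N) → ∀ i, (v.updateRow i x).det ∈ I) :
    x ∈ integralClosure N := by
  apply mem_integralClosure_of_isIntegral
  -- The extension of `I` to the Rees algebra: a nonzero finitely generated module, to be shown
  -- stable under the linear form of `x`.
  let M : Submodule (reesAlgebra N) (MvPolynomial (Fin n) S) :=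
    Submodule.span _ (MvPolynomial.C '' (I : Set S))
  have hC : ∀ s ∈ I, MvPolynomial.C s ∈ M := fun s hs => Submodule.subset_span ⟨s, hs, rfl⟩
  have hsmul : ∀ (s : S), ∀ m ∈ M, MvPolynomial.C s * m ∈ M := fun s m hm => by
    have := M.smul_mem (algebraMap S (reesAlgebra N) s) hm
    rwa [Subalgebra.smul_def, smul_eq_mul] at this
  refine isIntegral_of_smul_mem_submodule M ?_ ?_ _ ?_
  · obtain ⟨s, hs, hs0⟩ := Submodule.exists_mem_ne_zero_of_ne_bot h0
    exact (Submodule.ne_bot_iff _).2 ⟨_, hC s hs, by simpa using hs0⟩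
  · obtain ⟨t, ht⟩ := hfg
    classical
    refine ⟨t.image MvPolynomial.C, le_antisymm ?_ ?_⟩
    · rw [Finset.coe_image]
      refine Submodule.span_mono (Set.image_mono ?_)
      rw [← ht]
      exact Submodule.subset_span
    · rw [Finset.coe_image]
      refine Submodule.span_le.2 ?_
      rintro _ ⟨s, hs, rfl⟩
      rw [← ht] at hs
      have hle : Submodule.span S (t : Set S) ≤ ((Submodule.span (reesAlgebra N)
          (MvPolynomial.C '' (t : Set S))).restrictScalars S).comap
            (Algebra.linearMap S (MvPolynomial (Fin n) S)) :=
        Submodule.span_le.2 fun s hs => Submodule.subset_span ⟨s, hs, rfl⟩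
      exact hle hs
  · intro m hm
    induction hm using Submodule.span_induction with
    | zero => simp
    | add a b _ _ ha hb => rw [smul_add]; exact add_mem ha hb
    | smul a b _ hb => rw [smul_comm]; exact M.smul_mem _ hb
    | mem y hy =>
      obtain ⟨s, hs, rfl⟩ := hy
      rw [hI] at hs
      induction hs using Submodule.span_induction with
      | zero => simp
      | add a b _ _ ha hb => rw [map_add, smul_add]; exact add_mem ha hb
      | smul a b _ hb =>
        rw [smul_eq_mul, smul_eq_mul, map_mul, mul_left_comm]
        exact hsmul _ _ hb
      | mem d hd =>
        obtain ⟨v, hv, rfl⟩ := hd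
        rw [smul_eq_mul, mul_comm, ← MvPolynomial.smul_eq_C_mul, ← map_smul,
          ← sum_det_updateRow_smul, map_sum]
        refine sum_mem fun i _ => ?_
        rw [map_smul, MvPolynomial.smul_eq_C_mul, mul_comm]
        exact M.smul_mem (⟨linearForm S n (v i), Algebra.subset_adjoin ⟨v i, hv i, rfl⟩⟩ :
          reesAlgebra N) (hC _ (hx v hv i))

/-! ### Alternating maps, minors and coordinates on the bidual. -/

section Alternating

variable {E : Type*} [AddCommGroup E] [Module S E] {φ : E →ₗ[S] (Fin n → S)}

theorem det_comp_ne_zero_of_linearIndependent [IsDomain S] (hφ : Function.Injective φ)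
    {b : Fin n → E} (hb : LinearIndependent S b) : (Matrix.of fun i => φ (b i)).det ≠ 0 := by
  intro h
  obtain ⟨c, hc, hc0⟩ := Matrix.exists_vecMul_eq_zero_iff.2 h
  refine hc (funext fun i => Fintype.linearIndependent_iff.1 hb c (hφ ?_) i)
  rw [map_sum, map_zero, ← hc0]
  ext j
  simp [Matrix.vecMul, dotProduct]

/-- Cramer's rule in `S^n`, pulled back along the injection `φ`. -/
theorem det_comp_smul (hφ : Function.Injective φ) (b : Fin n → E) (y : E) :
    (Matrix.of fun i => φ (b i)).det • y =
      ∑ i, ((Matrix.of fun i => φ (b i)).updateRow i (φ y)).det • b i := by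
  apply hφ
  rw [map_smul, ← sum_det_updateRow_smul, map_sum]
  simp only [map_smul]
  rfl

/-- An alternating map on a module of rank `n` is determined up to torsion by its value on any
`n` vectors with nonzero determinant. -/
theorem alternatingMap_eq_zero [IsDomain S] {P : Type*} [AddCommGroup P] [Module S P]
    [Module.IsTorsionFree S P] (hφ : Function.Injective φ) {b : Fin n → E}
    (hb : (Matrix.of fun i => φ (b i)).det ≠ 0) {A : E [⋀^Fin n]→ₗ[S] P} (hA : A b = 0) :
    A = 0 := by
  -- On distinct basis vectors the pulled-back map takes the values `± A b`.
  have hL : A.compLinearMap (Fintype.linearCombination S b) = 0 := by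
    refine Module.Basis.ext_alternating (Pi.basisFun S (Fin n)) fun i hi => ?_
    let σ : Equiv.Perm (Fin n) := Equiv.ofBijective i (Finite.injective_iff_bijective.1 hi)
    have : (fun j => (Fintype.linearCombination S b) (Pi.basisFun S (Fin n) (i j))) = b ∘ σ := by
      ext j
      simp [Fintype.linearCombination_apply_single, σ]
    rw [AlternatingMap.compLinearMap_apply, AlternatingMap.zero_apply]
    refine (congrArg A this).trans ?_
    rw [A.map_perm, hA, smul_zero]
  ext v
  -- These are the Cramer coefficients of `det • v j` in terms of `b`.
  have h := DFunLike.congr_fun hL fun j i => ((Matrix.of fun i => φ (b i)).updateRow i (φ (v j))).det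
  have h' : A (fun j => (Matrix.of fun i => φ (b i)).det • v j) = 0 := by
    rw [AlternatingMap.zero_apply, AlternatingMap.compLinearMap_apply] at h
    rw [← h]
    congr 1
    ext j
    rw [det_comp_smul hφ, Fintype.linearCombination_apply]
  have h'' := A.toMultilinearMap.map_smul_univ (fun _ => (Matrix.of fun i => φ (b i)).det) v
  rw [AlternatingMap.coe_multilinearMap, h'] at h''
  exact (smul_eq_zero.1 h''.symm).resolve_left (Finset.prod_ne_zero_iff.2 fun _ _ => hb)

/-- The vector of `Sⁿ` attached to an element of the bidual of a module with `n` coordinates. -/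
def bidualCoord (φ : E →ₗ[S] (Fin n → S)) (ξ : Module.Dual S (Module.Dual S E)) : Fin n → S :=
  fun i => ξ (LinearMap.proj i ∘ₗ φ)

/-- A functional that extends to `S^n` is a combination of the coordinates of `φ`, on which `ξ` is
known. -/
theorem bidual_apply_comp (ξ : Module.Dual S (Module.Dual S E))
    (g : (Fin n → S) →ₗ[S] S) : ξ (g ∘ₗ φ) = g (bidualCoord φ ξ) := by
  have hg : g = ∑ i, g (Pi.single i 1) • LinearMap.proj i := by
    ext j
    simp [Pi.single_apply]
  have h : g ∘ₗ φ = ∑ i, g (Pi.single i 1) • (LinearMap.proj i ∘ₗ φ) := by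
    conv_lhs => rw [hg]
    ext y
    simp [LinearMap.sum_apply]
  conv_rhs => rw [hg]
  rw [h, map_sum]
  simp [bidualCoord]

/-- An element of the bidual whose coordinate vector comes from the module is an evaluation. -/
theorem bidual_eq_eval [IsDomain S] (hφ : Function.Injective φ) {b : Fin n → E}
    (hb : (Matrix.of fun i => φ (b i)).det ≠ 0) {ξ : Module.Dual S (Module.Dual S E)} {e : E}
    (he : φ e = bidualCoord φ ξ) : Module.Dual.eval S E e = ξ := by
  ext f
  let c : (Fin n → S) →ₗ[S] (Fin n → S) := Matrix.cramer (Matrix.of fun i => φ (b i)).transpose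
  let g : (Fin n → S) →ₗ[S] S := ∑ i, f (b i) • (LinearMap.proj i ∘ₗ c)
  -- Any functional extends to `S^n` once multiplied by the determinant of `b`.
  have hg : (Matrix.of fun i => φ (b i)).det • f = g ∘ₗ φ := by
    ext y
    rw [LinearMap.smul_apply, ← map_smul, det_comp_smul hφ, map_sum]
    simp [g, c, Matrix.cramer_transpose_apply, mul_comm]
  have h1 : (Matrix.of fun i => φ (b i)).det * ξ f = (Matrix.of fun i => φ (b i)).det * f e := by
    rw [← smul_eq_mul, ← map_smul, hg, bidual_apply_comp, ← he, ← smul_eq_mul,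
      ← LinearMap.smul_apply, hg, LinearMap.comp_apply]
  exact (mul_left_cancel₀ hb h1).symm

variable (φ) in
/-- The maximal minors of `φ`, as an alternating map. -/
noncomputable def minors : E [⋀^Fin n]→ₗ[S] S := Matrix.detRowAlternating.compLinearMap φ

theorem minors_apply (v : Fin n → E) : minors φ v = (Matrix.of fun i => φ (v i)).det := rfl

theorem minors_update (v : Fin n → E) (i : Fin n) (y : E) :
    minors φ (Function.update v i y) =
      ((Matrix.of fun i => φ (v i)).updateRow i (φ y)).det := by
  rw [minors_apply]
  congr 1
  ext j k
  by_cases h : j = i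
  · subst h; simp
  · simp [h]

variable (φ) in
/-- The ideal of maximal minors of `φ`: the image of `⋀ⁿ E` in `⋀ⁿ Sⁿ = S`. -/
noncomputable def minorsIdeal : Ideal S :=
  LinearMap.range (exteriorPower.alternatingMapLinearEquiv (minors φ))

theorem minorsIdeal_eq_span :
    minorsIdeal φ = Ideal.span {d | ∃ v : Matrix (Fin n) (Fin n) S,
      (∀ i, v i ∈ LinearMap.range φ) ∧ v.det = d} := by
  rw [minorsIdeal, LinearMap.range_eq_map, ← exteriorPower.ιMulti_span, Submodule.map_span,
    ← Set.range_comp]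
  refine congrArg (Submodule.span S) (Set.ext fun d => ⟨?_, ?_⟩)
  · rintro ⟨v, rfl⟩
    exact ⟨Matrix.of fun i => φ (v i), fun i => ⟨v i, rfl⟩, by simp [minors_apply]⟩
  · rintro ⟨v, hv, rfl⟩
    choose w hw using hv
    refine ⟨w, ?_⟩
    rw [Function.comp_apply, exteriorPower.alternatingMapLinearEquiv_apply_ιMulti, minors_apply]
    exact congrArg Matrix.det (funext hw)

end Alternating

/-! ### Use of divisoriality. -/

/-- If `⋀ⁿ E` maps onto a divisorial fractional ideal, then replacing a row of a matrix with rows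
in `φ E` by a vector of the bidual keeps its determinant in the ideal of maximal minors. -/
theorem det_updateRow_bidualCoord_mem [IsDomain S] {E : Type*} [AddCommGroup E] [Module S E]
    {φ : E →ₗ[S] (Fin n → S)} (hφ : Function.Injective φ)
    {I : FractionalIdeal S⁰ (FractionRing S)} (h0 : I ≠ 0) (hI : I⁻¹⁻¹ = I)
    {ψ : (⋀[S]^n E) →ₗ[S] FractionRing S} (hψ : LinearMap.range ψ = I)
    {b : Fin n → E} (hb : (Matrix.of fun i => φ (b i)).det ≠ 0)
    (ξ : Module.Dual S (Module.Dual S E)) (v : Fin n → E) (i : Fin n) :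
    ((Matrix.of fun i => φ (v i)).updateRow i (bidualCoord φ ξ)).det ∈ minorsIdeal φ := by
  let D : E [⋀^Fin n]→ₗ[S] FractionRing S := exteriorPower.alternatingMapLinearEquiv.symm ψ
  have hDψ : ∀ w, D w = ψ (exteriorPower.ιMulti S n w) := fun w => by simp [D]
  have hDI : ∀ w, D w ∈ I := fun w => by
    rw [hDψ, ← FractionalIdeal.mem_coe, ← hψ]
    exact ⟨_, rfl⟩
  let δ : FractionRing S := algebraMap S (FractionRing S) (minors φ b)
  have hδ : δ ≠ 0 := by
    simpa [δ, minors_apply] using hb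
  have hβ : D b ≠ 0 := by
    intro h
    have hD : D = 0 := alternatingMap_eq_zero hφ hb h
    have hψ0 : ψ = 0 := exteriorPower.alternatingMapLinearEquiv.symm.injective
      (by rw [map_zero]; exact hD)
    rw [hψ0, LinearMap.range_zero] at hψ
    exact h0 (FractionalIdeal.coeToSubmodule_eq_bot.1 hψ.symm)
  -- the two alternating maps are proportional
  have hprop : D b • ((Algebra.linearMap S (FractionRing S)).compAlternatingMap (minors φ)) = δ • D := by
    rw [← sub_eq_zero]
    refine alternatingMap_eq_zero hφ hb ?_
    simp [δ, mul_comm]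
  have hpropv : ∀ w, D b * algebraMap S (FractionRing S) (minors φ w) = δ * D w := fun w => by
    simpa using DFunLike.congr_fun hprop w
  have hpropψ : ∀ w, D b * algebraMap S (FractionRing S)
      (exteriorPower.alternatingMapLinearEquiv (minors φ) w) = δ * ψ w := by
    have : D b • ((Algebra.linearMap S (FractionRing S)) ∘ₗ exteriorPower.alternatingMapLinearEquiv (minors φ))
        = δ • ψ := by
      ext w
      simpa [hDψ] using hpropv w
    intro w
    simpa using LinearMap.congr_fun this w
  let G : (Fin n → S) →ₗ[S] S :=
    LinearMap.proj i ∘ₗ Matrix.cramer (Matrix.of fun i => φ (v i)).transpose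
  have hG : ∀ z, G z = ((Matrix.of fun i => φ (v i)).updateRow i z).det := fun z => by
    simp [G, Matrix.cramer_transpose_apply]
  set x := bidualCoord φ ξ
  rw [← hG]
  have hI' : I⁻¹ ≠ 0 := fun h => h0 (by rw [← hI, h, FractionalIdeal.inv_zero'])
  -- Multiplication by `D b / δ` carries the ideal of minors onto `I`, so the double inverse can be
  -- tested on `I`.
  have key : D b / δ * algebraMap S (FractionRing S) (G x) ∈ I := by
    rw [← hI, FractionalIdeal.mem_inv_iff hI']
    intro c hc
    have hcD : ∀ w, ∃ s, algebraMap S (FractionRing S) s = c * D w := fun w =>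
      (FractionalIdeal.mem_one_iff _).1 ((FractionalIdeal.mem_inv_iff h0).1 hc _ (hDI w))
    choose F hF using hcD
    let f : Module.Dual S E :=
      { toFun := fun y => F (Function.update v i y)
        map_add' := fun y z => IsFractionRing.injective S (FractionRing S) (by
          simp [hF, mul_add])
        map_smul' := fun s y => IsFractionRing.injective S (FractionRing S) (by
          simp [hF, Algebra.smul_def, mul_left_comm]) }
    have hf : ∀ y, algebraMap S (FractionRing S) (f y) = c * D (Function.update v i y) := fun y => hF _
    -- Clearing denominators makes `q • f` extend to `S^n`, where `ξ` is computed by coordinates.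
    obtain ⟨p, q, hq, hpq⟩ := IsFractionRing.div_surjective (A := S) (c * (D b / δ))
    have hq' : algebraMap S (FractionRing S) q ≠ 0 := by simpa using nonZeroDivisors.ne_zero hq
    have hfG : q • f = (p • G) ∘ₗ φ := by
      ext y
      apply IsFractionRing.injective S (FractionRing S)
      have h1 := hpropv (Function.update v i y)
      rw [minors_update, ← hG] at h1
      rw [LinearMap.smul_apply, LinearMap.comp_apply, LinearMap.smul_apply, smul_eq_mul,
        smul_eq_mul, map_mul, map_mul, hf]
      rw [div_eq_iff hq'] at hpq
      rw [hpq]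
      field_simp
      linear_combination (-c) * h1
    have h2 : q * ξ f = p * G x := by
      rw [← smul_eq_mul, ← map_smul, hfG, bidual_apply_comp, LinearMap.smul_apply, smul_eq_mul]
    refine (FractionalIdeal.mem_one_iff _).2 ⟨ξ f, ?_⟩
    have h3 := congrArg (algebraMap S (FractionRing S)) h2
    rw [map_mul, map_mul] at h3
    rw [div_eq_iff hq'] at hpq
    rw [hpq] at h3
    apply mul_left_cancel₀ hq'
    rw [h3]
    ring
  rw [← FractionalIdeal.mem_coe, ← hψ] at key
  obtain ⟨w, hw⟩ := key
  refine ⟨w, IsFractionRing.injective S (FractionRing S) ?_⟩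
  apply mul_left_cancel₀ hβ
  rw [hpropψ, hw]
  field_simp

end ReesModule

theorem proposition4p7 {S E : Type*} [CommRing S] [IsDomain S] [IsIntegrallyClosed S]
    [AddCommGroup E] [Module S E] [Module.Finite S E] [Module.IsTorsionFree S E]
    (hE : ReesModule.IsIntegrallyClosedModule S E)
    (hdet : ReesModule.IsDivisorial S (ReesModule.Determinant S E)) :
    Module.IsReflexive S E := by
  obtain ⟨φ, hφ, hcl⟩ := hE
  obtain ⟨I, h0, hI, ⟨θ⟩⟩ := hdet
  -- Factoring through the torsion quotient loses nothing: the range is still all of `I`.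
  let ψ : (⋀[S]^(Module.finrank S E) E) →ₗ[S] FractionRing S :=
    (I : Submodule S (FractionRing S)).subtype ∘ₗ θ.toLinearMap ∘ₗ Submodule.mkQ _
  have hψ : LinearMap.range ψ = I := by
    rw [LinearMap.range_comp, LinearMap.range_comp, Submodule.range_mkQ, Submodule.map_top,
      LinearEquiv.range, Submodule.map_top, Submodule.range_subtype]
  obtain ⟨b, hb⟩ : ∃ b : Fin (Module.finrank S E) → E, LinearIndependent S b := by
    obtain ⟨b, hb⟩ := exists_linearIndependent_of_le_finrank (R := S) (M := E) le_rfl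
    exact ⟨b, hb⟩
  have hdet := ReesModule.det_comp_ne_zero_of_linearIndependent hφ hb
  refine ⟨⟨fun y z hyz => hφ (funext fun i => ?_), fun ξ => ?_⟩⟩
  · exact LinearMap.congr_fun hyz (LinearMap.proj i ∘ₗ φ)
  · have hmem : ReesModule.bidualCoord φ ξ ∈ LinearMap.range φ := by
      rw [← hcl]
      refine ReesModule.mem_integralClosure_of_det_updateRow_mem
        (I := ReesModule.minorsIdeal φ) ?_ ?_ ReesModule.minorsIdeal_eq_span ?_
      · rw [ReesModule.minorsIdeal, LinearMap.range_eq_map]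
        exact Module.Finite.fg_top.map _
      · refine (Submodule.ne_bot_iff _).2 ⟨_, ⟨exteriorPower.ιMulti S _ b, rfl⟩, ?_⟩
        rwa [exteriorPower.alternatingMapLinearEquiv_apply_ιMulti]
      · intro v hv i
        choose w hw using hv
        have hvw : v = Matrix.of fun i => φ (w i) := funext fun i => (hw i).symm
        rw [hvw]
        exact ReesModule.det_updateRow_bidualCoord_mem hφ h0 hI hψ hdet ξ w i
    obtain ⟨e, he⟩ := hmem
    exact ⟨e, ReesModule.bidual_eq_eval hφ hdet he⟩
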